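/- Let $d,L\ge 1$. A cylindric shape of period $(d,L)$ is a weakly decreasing sequence of integers $\lambda=(\lambda_i)_{i\in\mathbb Z}$ with $\lambda_i=\lambda_{i+d}+L$ for all $i$; write $\mu\subseteq\lambda$ if $\mu_i\le\lambda_i$ for all $i$. Cells are the classes $\langle i,j\rangle$ of $(i,j)$ in $\mathbb Z^2/\mathbb Z(-d,L)$ (row $i$, column $j$). For $\mu\subseteq\lambda$ let $Y_{\lambda/\mu}=\{\langle i,j\rangle:\mu_i<j\le\lambda_i\}$ and $|\lambda/\mu|=\#Y_{\lambda/\mu}$. A standard cylindric tableau of shape $\lambda/\mu$ is a bijection $Y_{\lambda/\mu}\to\{1,\dots,|\lambda/\mu|\}$ that increases along rows (left to right) and down columns; $\mathrm{SCT}(\lambda/\mu)$ is the set of these. Internal insertion. Let $T\in\mathrm{SCT}(\lambda/\mu)$ and let $i$ be a row with $\mu_{i-1}>\mu_i$. If the cell $\langle i,\mu_i+1\rangle$ has no entry, add $1$ to both $\mu_i$ and $\lambda_i$, leaving the entries unchanged; the added cell is then $\langle i,\lambda_i+1\rangle$ (for the old $\lambda_i$). Otherwise remove its entry $a$ and add $1$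 to $\mu_i$, and insert $a$ into row $i+1$, where inserting $a$ into row $r$ means: if $a$ exceeds all entries of row $r$, place $a$ in the new cell $\langle r,\lambda_r+1\rangle$, add $1$ to $\lambda_r$ and stop; otherwise let $a$ replace the smallest entry $a'>a$ of row $r$ and insert $a'$ into row $r+1$. Here a change to row $r$ of a shape is made in all rows congruent to $r$ modulo $d$. The correspondence $\mathrm{CRS}$. Let $T\in\mathrm{SCT}(\alpha/\mu)$ and $U\in\mathrm{SCT}(\beta/\mu)$, with $n=|\alpha/\mu|$ and $m=|\beta/\mu|$. Let $P_0=T$ and let $Q_0$ be the empty tableau of shape $\alpha/\alpha$. For $k=1,\dots,m$, let $P_k$ be obtained from $P_{k-1}$ by internal insertion at the row $i$ of the cell of $U$ containing $k$, and let $Q_k$ be obtained from $Q_{k-1}$ by adding to it, with entry $k$, the cell that this insertion adds to the outer shape. Set $\mathrm{CRS}(T,U)=(P_m,Q_m)$. Statement. For all $T\in\mathrm{SCT}(\alpha/\mu)$ and $U\in\mathrm{SCT}(\beta/\mu)$, $\mathrm{CRS}(T,U)$ is a pair $(P,Q)\in\mathrm{SCT}(\lambda/\beta)\times\mathrm{SCT}(\lambda/\alpha)$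 for some cylindric shape $\lambda\supseteq\alpha,\beta$ with $|\lambda/\beta|=n$ and $|\lambda/\alpha|=m$; and if $\mathrm{CRS}(T,U)=(P,Q)$, then $\mathrm{CRS}(U,T)=(Q,P)$. -/

import Mathlib

namespace CylindricRS

/-- The cylinder `ℤ² / ℤ(-d, L)`; its elements are called cells. -/
abbrev Cylinder (d L : ℕ) : Type :=
  (ℤ × ℤ) ⧸ AddSubgroup.zmultiples ((-(d : ℤ), (L : ℤ)) : ℤ × ℤ)

/-- The cell `⟨i, j⟩`, the class of the square in row `i` and column `j`. -/
def cell (d L : ℕ) (i j : ℤ) : Cylinder d L := QuotientAddGroup.mk (i, j)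

/-- Cylindric shapes of period `(d, L)`. -/
@[ext]
structure CylShape (d L : ℕ) where
  row : ℤ → ℤ
  antitone_row : Antitone row
  periodic : ∀ i, row i = row (i + d) + L

/-- Containment of cylindric shapes. -/
instance (d L : ℕ) : LE (CylShape d L) where
  le mu lam := ∀ i, mu.row i ≤ lam.row i

/-- The Young diagram of a cylindric shape. -/
def young {d L : ℕ} (lam : CylShape d L) : Set (Cylinder d L) :=
  {c | ∃ i j : ℤ, cell d L i j = c ∧ j ≤ lam.row i}

/-- The cylindric Young diagram of shape `lam / mu`. -/
def skew {d L : ℕ} (lam mu : CylShape d L) : Set (Cylinder d L) := young lam \ young mu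

/-- The number of cells `|lam / mu|`. -/
noncomputable def size {d L : ℕ} (lam mu : CylShape d L) : ℕ := (skew lam mu).ncard

/-- Standard cylindric tableaux of shape `lam / mu`. The filling of the (finite) diagram by the
numbers `1, …, |lam / mu|` is extended by `0` to the other cells of the cylinder. -/
structure SCT {d L : ℕ} (lam mu : CylShape d L) where
  entry : Cylinder d L →₀ ℕ
  inner_le_outer : mu ≤ lam
  support_eq : (entry.support : Set (Cylinder d L)) = skew lam mu
  bijOn : Set.BijOn entry (skew lam mu) (Set.Icc 1 (size lam mu))
  col_lt : ∀ i j : ℤ, cell d L i j ∈ skew lam mu → cell d L (i + 1) j ∈ skew lam mu →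
    entry (cell d L i j) < entry (cell d L (i + 1) j)
  row_lt : ∀ i j : ℤ, cell d L i j ∈ skew lam mu → cell d L i (j + 1) ∈ skew lam mu →
    entry (cell d L i j) < entry (cell d L i (j + 1))

/-- The data on which the insertion algorithm operates: the rows of the outer and inner shapes and
the entries of the cells, where the value `0` marks a cell without entry. Nothing is required
of these data, since the intermediate steps of an insertion are not tableaux. -/
@[ext]
structure Filling (d L : ℕ) where
  outer : ℤ → ℤ
  inner : ℤ → ℤ
  entry : Cylinder d L →₀ ℕ

/-- A standard cylindric tableau, together with its two shapes, as a filling. -/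
def SCT.toFilling {d L : ℕ} {lam mu : CylShape d L} (T : SCT lam mu) : Filling d L where
  outer := lam.row
  inner := mu.row
  entry := T.entry

/-- Add one cell to row `i` (hence to all rows congruent to `i` modulo `d`). -/
def addToRow (d : ℕ) (i : ℤ) (f : ℤ → ℤ) : ℤ → ℤ :=
  fun k => if (d : ℤ) ∣ k - i then f k + 1 else f k

/-- Put `a` into the cell `⟨i, j⟩`, which is added to the outer shape in row `i`. -/
noncomputable def Filling.place {d L : ℕ} (S : Filling d L) (i j : ℤ) (a : ℕ) : Filling d L where
  outer := addToRow d i S.outer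
  inner := S.inner
  entry := S.entry.update (cell d L i j) a

/-- Replace the entry of the cell `c` by `a`, keeping the shapes. -/
noncomputable def Filling.replace {d L : ℕ} (S : Filling d L) (c : Cylinder d L) (a : ℕ) :
    Filling d L where
  outer := S.outer
  inner := S.inner
  entry := S.entry.update c a

/-- The cell `⟨r, j⟩` holds the smallest among the entries larger than `a` in row `r`. -/
def Filling.IsBumped {d L : ℕ} (S : Filling d L) (r : ℤ) (a : ℕ) (j : ℤ) : Prop :=
  a < S.entry (cell d L r j) ∧
    ∀ j' : ℤ, a < S.entry (cell d L r j') → S.entry (cell d L r j) ≤ S.entry (cell d L r j')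

/-- The number of entries larger than `a`; it decreases along an insertion. -/
noncomputable def Filling.numLarger {d L : ℕ} (S : Filling d L) (a : ℕ) : ℕ :=
  {c | a < S.entry c}.ncard

theorem Filling.numLarger_replace_lt {d L : ℕ} (S : Filling d L) (c : Cylinder d L) (a : ℕ)
    (h : a < S.entry c) : (S.replace c a).numLarger (S.entry c) < S.numLarger a := by
  classical
  refine Set.ncard_lt_ncard ?_ ?_
  · rw [Set.ssubset_iff_of_subset]
    · refine ⟨c, h, ?_⟩
      simp only [Filling.replace, Finsupp.coe_update, Set.mem_ofPred_eq, Function.update_self]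
      omega
    · intro x hx
      simp only [Filling.replace, Finsupp.coe_update, Set.mem_ofPred_eq,
        Function.update_apply] at hx ⊢
      split_ifs at hx <;> omega
  · refine S.entry.support.finite_toSet.subset fun x hx => ?_
    simp only [Set.mem_ofPred_eq] at hx
    simp only [Finset.mem_coe, Finsupp.mem_support_iff]
    omega

open Classical in
/-- Insert `a` into row `r`. If no entry of the row is larger than `a`, then `a` is placed in a
new cell at the end of the row; otherwise `a` replaces the smallest larger entry of the row, which
is then inserted into the next row. The result is the final filling together with the
coordinates of the new cell. -/
noncomputable def Filling.insertRow {d L : ℕ} (S : Filling d L) (r : ℤ) (a : ℕ) :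
    Filling d L × (ℤ × ℤ) :=
  if h : ∃ j : ℤ, S.IsBumped r a j then
    (S.replace (cell d L r h.choose) a).insertRow (r + 1) (S.entry (cell d L r h.choose))
  else
    (S.place r (S.outer r + 1) a, (r, S.outer r + 1))
termination_by S.numLarger a
decreasing_by exact S.numLarger_replace_lt _ a h.choose_spec.1

/-- Internal insertion at row `i`, with the coordinates of the cell added to the outer shape. -/
noncomputable def Filling.ins {d L : ℕ} (i : ℤ) (S : Filling d L) : Filling d L × (ℤ × ℤ) :=
  if S.entry (cell d L i (S.inner i + 1)) = 0 then
    (⟨addToRow d i S.outer, addToRow d i S.inner, S.entry⟩, (i, S.outer i + 1))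
  else
    Filling.insertRow
      ⟨S.outer, addToRow d i S.inner, S.entry.update (cell d L i (S.inner i + 1)) 0⟩
      (i + 1) (S.entry (cell d L i (S.inner i + 1)))

/-- The row `i ∈ {1, …, d}` of the cell that contains `k`. -/
noncomputable def SCT.rowOf {d L : ℕ} {lam mu : CylShape d L} (U : SCT lam mu) (k : ℕ) : ℤ :=
  Classical.epsilon fun i : ℤ => 1 ≤ i ∧ i ≤ d ∧ ∃ j : ℤ, U.entry (cell d L i j) = k

/-- The pairs `(P_k, Q_k)` of the cylindric Robinson–Schensted algorithm applied to `(T, U)`. -/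
noncomputable def crsStep {d L : ℕ} {al be mu : CylShape d L} (T : SCT al mu) (U : SCT be mu) :
    ℕ → Filling d L × Filling d L
  | 0 => (T.toFilling, ⟨al.row, al.row, 0⟩)
  | k + 1 =>
    let PQ := crsStep T U k
    let R := PQ.1.ins (U.rowOf (k + 1))
    (R.1, PQ.2.place R.2.1 R.2.2 (k + 1))

/-- The cylindric Robinson–Schensted correspondence, with the two resulting tableaux viewed as
fillings. -/
noncomputable def CRS {d L : ℕ} {al be mu : CylShape d L} (T : SCT al mu) (U : SCT be mu) :
    Filling d L × Filling d L :=
  crsStep T U (size be mu)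

end CylindricRS

/-! A standard cylindric tableau is a chain of shapes growing by one cell at a time. It is therefore
the inner shape together with the word over `ZMod d` that lists the rows of the added cells, where
every partial shape must be weakly decreasing (`SCT.exists_encodes`, `Filling.Encodes.exists_SCT`).

On words, internal insertion at row `x` is a single pass with a carrier that starts at `x`. If the
current letter differs from the carrier, both are kept; if they agree, both are raised by one. The
carrier is the row in which the new chain is one cell ahead of the old one, and a raise is a bump
(`Filling.Encodes.ins`). This rule keeps all partial shapes weakly decreasing
(`IsLattice.insertWord`).

The rule is symmetric in letter and carrier. Inserting the letters of the word `u` of `U` one after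
another into the word `w` of `T` fills a rectangular grid of local rules with `w` along one side and
`u` along the adjacent side. On the opposite sides one reads the word of `P` and the final carriers,
which are the rows of the new cells and hence the word of `Q`. Exchanging `T` and `U` transposes the
grid (`growth_symm`), so it exchanges `P` and `Q`. -/

namespace CylindricRS

variable {d L : ℕ}

/-! ### Words and their partial counts -/

/-- The number of letters `x` among the first `s` letters of `w`. -/
def count (w : ℕ → ZMod d) (s : ℕ) (x : ZMod d) : ℤ :=
  ∑ t ∈ Finset.range s, if w t = x then 1 else 0

@[simp]
theorem count_zero (w : ℕ → ZMod d) (x : ZMod d) : count w 0 x = 0 := by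
  simp [count]

theorem count_succ (w : ℕ → ZMod d) (s : ℕ) (x : ZMod d) :
    count w (s + 1) x = count w s x + if w s = x then 1 else 0 := by
  rw [count, count, Finset.sum_range_succ]

theorem count_mono (w : ℕ → ZMod d) (x : ZMod d) : Monotone fun s => count w s x := by
  refine monotone_nat_of_le_succ fun s => ?_
  rw [count_succ]
  split_ifs <;> omega

theorem count_nonneg (w : ℕ → ZMod d) (s : ℕ) (x : ZMod d) : 0 ≤ count w s x := by
  simpa using count_mono w x (Nat.zero_le s)

theorem count_congr {w w' : ℕ → ZMod d} {s : ℕ} (h : ∀ t < s, w t = w' t) (x : ZMod d) :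
    count w s x = count w' s x :=
  Finset.sum_congr rfl fun t ht => by rw [h t (Finset.mem_range.1 ht)]

theorem count_eq_of_forall_ne {w : ℕ → ZMod d} {s t : ℕ} {x : ZMod d} (hst : s ≤ t)
    (h : ∀ u, s ≤ u → u < t → w u ≠ x) : count w t x = count w s x := by
  induction t, hst using Nat.le_induction with
  | base => rfl
  | succ t hst ih =>
    rw [count_succ, if_neg (h t hst (by omega)), ih fun u h1 h2 => h u h1 (by omega), add_zero]

/-- A discrete intermediate value property: the count starts at `0` and rises by one exactly at the
occurrences of `x`. -/
theorem exists_count_eq {w : ℕ → ZMod d} {s : ℕ} {x : ZMod d} {q : ℤ} (h0 : 0 ≤ q)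
    (h : q < count w s x) : ∃ t < s, w t = x ∧ count w t x = q := by
  induction s with
  | zero => simp at h; omega
  | succ s ih =>
    by_cases hq : q < count w s x
    · obtain ⟨t, ht, h1⟩ := ih hq
      exact ⟨t, by omega, h1⟩
    · rw [count_succ] at h
      split_ifs at h with hw
      · exact ⟨s, by omega, hw, by omega⟩
      · omega

theorem count_lt_count {w : ℕ → ZMod d} {s t : ℕ} {x : ZMod d} (hst : s < t) (h : w s = x) :
    count w s x < count w t x := by
  have h1 := count_mono w x (Nat.succ_le_of_lt hst)
  simp only [Nat.succ_eq_add_one, count_succ, if_pos h] at h1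
  omega

/-! ### Cells -/

theorem periodic_sub_mul {g : ℤ → ℤ} (hg : ∀ i, g i = g (i + d) + L) (k z : ℤ) :
    g (k - z * d) = g k + z * L := by
  induction z using Int.induction_on with
  | zero => simp
  | succ z ih =>
    rw [hg, show k - ((z : ℤ) + 1) * d + d = k - z * d by ring, ih]
    ring
  | pred z ih =>
    have h := hg (k - -(z : ℤ) * d)
    rw [ih, show k - -(z : ℤ) * d + d = k - (-(z : ℤ) - 1) * d by ring] at h
    linarith

/-- A shift by `(-d, L)` moves the column and the boundary `g` by the same amount. Row class and
offset from `g` are thus faithful coordinates on the cylinder, and later arguments avoid the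
quotient. -/
theorem cell_eq_cell_iff {g : ℤ → ℤ} (hg : ∀ i, g i = g (i + d) + L) (k j r q : ℤ) :
    cell d L k j = cell d L r q ↔ (k : ZMod d) = r ∧ j - g k = q - g r := by
  rw [cell, cell, QuotientAddGroup.eq, AddSubgroup.mem_zmultiples_iff,
    ZMod.intCast_eq_intCast_iff_dvd_sub]
  constructor
  · rintro ⟨z, hz⟩
    simp only [Prod.smul_mk, smul_eq_mul, Prod.neg_mk, Prod.mk_add_mk, Prod.mk.injEq] at hz
    have h1 : r = k - z * d := by linarith [hz.1]
    refine ⟨⟨-z, by linarith⟩, ?_⟩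
    rw [h1, periodic_sub_mul hg]
    linarith [hz.2]
  · rintro ⟨⟨z, hz⟩, h⟩
    have h1 : r = k - -z * d := by linarith
    rw [h1, periodic_sub_mul hg] at h
    refine ⟨-z, ?_⟩
    simp only [Prod.smul_mk, smul_eq_mul, Prod.neg_mk, Prod.mk_add_mk, Prod.mk.injEq]
    constructor <;> linarith

theorem exists_cell_eq (c : Cylinder d L) : ∃ i j, cell d L i j = c := by
  obtain ⟨⟨i, j⟩, h⟩ := QuotientAddGroup.mk_surjective c
  exact ⟨i, j, h⟩

theorem cell_mem_young_iff (lam : CylShape d L) (i j : ℤ) :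
    cell d L i j ∈ young lam ↔ j ≤ lam.row i := by
  constructor
  · rintro ⟨k, q, h, hq⟩
    have := ((cell_eq_cell_iff lam.periodic _ _ _ _).1 h).2
    omega
  · exact fun h => ⟨i, j, rfl, h⟩

theorem cell_mem_skew_iff (lam mu : CylShape d L) (i j : ℤ) :
    cell d L i j ∈ skew lam mu ↔ mu.row i < j ∧ j ≤ lam.row i := by
  rw [skew, Set.mem_sdiff, cell_mem_young_iff, cell_mem_young_iff]
  omega

theorem addToRow_apply (i : ℤ) (f : ℤ → ℤ) (k : ℤ) :
    addToRow d i f k = f k + if (i : ZMod d) = k then 1 else 0 := by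
  simp only [addToRow, ZMod.intCast_eq_intCast_iff_dvd_sub]
  split_ifs <;> simp

/-! ### Fillings encoded by words -/

/-- The filling `S` has the entries `1, …, n`, and `s + 1` is the cell added in row `w s` to the
shape formed by the inner shape and the entries up to `s`. -/
structure Filling.Encodes (S : Filling d L) (n : ℕ) (w : ℕ → ZMod d) : Prop where
  periodic : ∀ i, S.inner i = S.inner (i + d) + L
  outer_eq : ∀ k : ℤ, S.outer k = S.inner k + count w n k
  entry_iff : ∀ (k j : ℤ) (s : ℕ), S.entry (cell d L k j) = s + 1 ↔
    s < n ∧ w s = k ∧ j = S.inner k + count w s k + 1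

/-- This turns equality of words into equality of fillings, which is how the symmetry of the grid
reaches the tableaux. Letters from position `n` on carry no information. -/
theorem Filling.Encodes.eq_of_inner_eq {S S' : Filling d L} {n : ℕ} {w w' : ℕ → ZMod d}
    (h : S.Encodes n w) (h' : S'.Encodes n w') (hw : ∀ s < n, w s = w' s)
    (hi : S.inner = S'.inner) : S = S' := by
  ext c
  · rw [h.outer_eq, h'.outer_eq, hi, count_congr hw]
  · rw [hi]
  · obtain ⟨k, j, rfl⟩ := exists_cell_eq c
    have key (s : ℕ) : S.entry (cell d L k j) = s + 1 ↔ S'.entry (cell d L k j) = s + 1 := by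
      rw [h.entry_iff, h'.entry_iff, hi]
      refine and_congr_right fun hs => ?_
      rw [hw s hs, count_congr fun t ht => hw t (ht.trans hs)]
    rcases h0 : S.entry (cell d L k j) with _ | s
    · rcases h1 : S'.entry (cell d L k j) with _ | s
      · rfl
      · rw [(key s).2 h1] at h0
        omega
    · exact ((key s).1 h0).symm

/-- Successive cells of a row hold the successive occurrences of its letter, so the entries up to
`s` form an initial segment of the row. -/
theorem Filling.Encodes.entry_le_iff {S : Filling d L} {n : ℕ} {w : ℕ → ZMod d}
    (h : S.Encodes n w) {s : ℕ} (hs : s ≤ n) (k j : ℤ) :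
    (S.entry (cell d L k j) ≠ 0 ∧ S.entry (cell d L k j) ≤ s) ↔
      S.inner k < j ∧ j ≤ S.inner k + count w s k := by
  constructor
  · rintro ⟨h0, h1⟩
    obtain ⟨t, ht⟩ := Nat.exists_eq_succ_of_ne_zero h0
    obtain ⟨-, hw, hj⟩ := (h.entry_iff k j t).1 ht
    have := count_lt_count (s := t) (t := s) (by omega) hw
    have := count_nonneg w t k
    omega
  · rintro ⟨h0, h1⟩
    obtain ⟨t, ht, hw, hq⟩ := exists_count_eq (w := w) (s := s) (x := k)
      (q := j - S.inner k - 1) (by omega) (by omega)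
    have := (h.entry_iff k j t).2 ⟨by omega, hw, by omega⟩
    omega

theorem Filling.Encodes.entry_le {S : Filling d L} {n : ℕ} {w : ℕ → ZMod d}
    (h : S.Encodes n w) (k j : ℤ) : S.entry (cell d L k j) ≤ n := by
  rcases h0 : S.entry (cell d L k j) with _ | s
  · omega
  · have := ((h.entry_iff k j s).1 h0).1
    omega

/-- The rows `mu + count w s`, `s ≤ n`, are weakly decreasing. -/
def IsLattice (mu : ℤ → ℤ) (n : ℕ) (w : ℕ → ZMod d) : Prop :=
  ∀ s ≤ n, Antitone fun k : ℤ => mu k + count w s k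

/-- A filling encoded by a lattice word is a standard cylindric tableau. -/
theorem Filling.Encodes.exists_SCT (hL : 0 < L) {S : Filling d L} {n : ℕ}
    {w : ℕ → ZMod d} (h : S.Encodes n w) {lam mu : CylShape d L} (hlam : S.outer = lam.row)
    (hmu : S.inner = mu.row) (hl : IsLattice mu.row n w) :
    size lam mu = n ∧ ∃ P : SCT lam mu, P.toFilling = S := by
  have hrow (k : ℤ) : lam.row k = mu.row k + count w n k := by
    rw [← hlam, ← hmu, h.outer_eq]
  have hskew (k j : ℤ) : cell d L k j ∈ skew lam mu ↔ S.entry (cell d L k j) ≠ 0 := by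
    rw [cell_mem_skew_iff, hrow, ← hmu, ← h.entry_le_iff le_rfl]
    have := h.entry_le k j
    tauto
  have hbij : Set.BijOn S.entry (skew lam mu) (Set.Icc 1 n) := by
    refine ⟨fun c hc => ?_, fun c hc c' hc' hcc => ?_, fun a ha => ?_⟩
    · obtain ⟨k, j, rfl⟩ := exists_cell_eq c
      have := h.entry_le k j
      have := (hskew k j).1 hc
      exact ⟨by omega, by omega⟩
    · obtain ⟨k, j, rfl⟩ := exists_cell_eq c
      obtain ⟨k', j', rfl⟩ := exists_cell_eq c'
      obtain ⟨s, hs⟩ := Nat.exists_eq_succ_of_ne_zero ((hskew k j).1 hc)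
      obtain ⟨-, h2, h3⟩ := (h.entry_iff _ _ _).1 hs
      obtain ⟨-, h2', h3'⟩ := (h.entry_iff _ _ _).1 (hcc.symm.trans hs)
      rw [cell_eq_cell_iff h.periodic]
      refine ⟨h2.symm.trans h2', ?_⟩
      rw [← h2] at h3
      rw [← h2'] at h3'
      omega
    · obtain ⟨s, rfl⟩ := Nat.exists_eq_succ_of_ne_zero (show a ≠ 0 by have := ha.1; omega)
      obtain ⟨k, hk⟩ := ZMod.intCast_surjective (w s)
      have h1 := (h.entry_iff k (S.inner k + count w s k + 1) s).2
        ⟨by have := ha.2; omega, hk.symm, rfl⟩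
      exact ⟨_, (hskew _ _).2 (by omega), h1⟩
  have hsize : size lam mu = n := by
    rw [size, ← hbij.injOn.ncard_image, hbij.image_eq, ← Finset.coe_Icc,
      Set.ncard_coe_finset, Nat.card_Icc]
    omega
  refine ⟨hsize, ⟨S.entry, fun k => ?_, ?_, ?_, fun k j h1 h2 => ?_, fun k j h1 h2 => ?_⟩, ?_⟩
  · have := count_nonneg w n k
    rw [hrow]
    omega
  · ext c
    obtain ⟨k, j, rfl⟩ := exists_cell_eq c
    rw [hskew]
    simp
  · rw [hsize]
    exact hbij
  · rw [hskew] at h1 h2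
    obtain ⟨s, hs⟩ := Nat.exists_eq_succ_of_ne_zero h2
    obtain ⟨hsn, hw, hj⟩ := (h.entry_iff _ _ _).1 hs
    -- Once `s + 1` is added in row `k + 1`, that row reaches column `j`; the lattice condition at
    -- this stage makes row `k` reach it too.
    have ha := hl (s + 1) hsn (show k ≤ k + 1 by omega)
    have h3 := (h.entry_le_iff (s := s + 1) hsn (k + 1) j).1 ⟨h2, hs.le⟩
    have h5 := ((h.entry_le_iff (s := n) le_rfl k j).1 ⟨h1, h.entry_le k j⟩).1
    simp only [← hmu] at ha
    have h4 := (h.entry_le_iff (s := s + 1) hsn k j).2 ⟨h5, by omega⟩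
    rw [hs]
    -- Equal entries would put `k` and `k + 1` in the same class, so `d = 1`, and would give these
    -- rows the same inner boundary. The period then contradicts `0 < L`.
    refine lt_of_le_of_ne h4.2 fun he => ?_
    obtain ⟨-, hw', hj'⟩ := (h.entry_iff _ _ _).1 he
    have hd1 := hw.symm.trans hw'
    rw [← hw] at hj
    rw [← hw'] at hj'
    have hd2 : ((d : ℕ) : ℤ) ∣ 1 := by
      rw [ZMod.intCast_eq_intCast_iff_dvd_sub] at hd1
      rw [← dvd_neg]
      simpa using hd1
    have hd3 : d = 1 := by exact_mod_cast Int.eq_one_of_dvd_one (by omega) hd2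
    have := h.periodic k
    rw [show k + (d : ℤ) = k + 1 by omega] at this
    omega
  · rw [hskew] at h1 h2
    obtain ⟨s, hs⟩ := Nat.exists_eq_succ_of_ne_zero h2
    obtain ⟨hsn, hw, hj⟩ := (h.entry_iff _ _ _).1 hs
    have h5 := ((h.entry_le_iff (s := n) le_rfl k j).1 ⟨h1, h.entry_le k j⟩).1
    have h4 := (h.entry_le_iff (s := s) hsn.le k j).2 ⟨h5, by omega⟩
    omega
  · exact Filling.ext hlam.symm hmu.symm rfl

theorem SCT.entry_lt_entry {lam mu : CylShape d L} (T : SCT lam mu) {k j j' : ℤ}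
    (hj : mu.row k < j) (hjj : j < j') (hj' : j' ≤ lam.row k) :
    T.entry (cell d L k j) < T.entry (cell d L k j') := by
  have hstep (q : ℤ) (h1 : mu.row k < q) (h2 : q + 1 ≤ lam.row k) :
      T.entry (cell d L k q) < T.entry (cell d L k (q + 1)) :=
    T.row_lt k q ((cell_mem_skew_iff _ _ _ _).2 ⟨h1, by omega⟩)
      ((cell_mem_skew_iff _ _ _ _).2 ⟨by omega, h2⟩)
  induction j', (show j + 1 ≤ j' from hjj) using Int.leInduction with
  | base => exact hstep j hj hj'
  | succ q hq ih => exact (ih (by omega) (by omega)).trans (hstep q (by omega) hj')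

/-- A standard cylindric tableau is encoded by a lattice word. -/
theorem SCT.exists_encodes {lam mu : CylShape d L} (T : SCT lam mu) :
    ∃ w : ℕ → ZMod d, T.toFilling.Encodes (size lam mu) w ∧
      IsLattice mu.row (size lam mu) w := by
  classical
  set n := size lam mu
  have hne (k j : ℤ) : T.entry (cell d L k j) ≠ 0 ↔ mu.row k < j ∧ j ≤ lam.row k := by
    rw [← cell_mem_skew_iff, ← T.support_eq]
    simp
  have hcell {k j k' j' : ℤ} (h0 : T.entry (cell d L k j) ≠ 0)
      (h : T.entry (cell d L k j) = T.entry (cell d L k' j')) :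
      cell d L k j = cell d L k' j' :=
    T.bijOn.injOn ((cell_mem_skew_iff _ _ _ _).2 ((hne k j).1 h0))
      ((cell_mem_skew_iff _ _ _ _).2 ((hne k' j').1 (h ▸ h0))) h
  -- The letter is the row class of the cell holding `s + 1`; the value `0` is a dummy for numbers
  -- that do not occur.
  have hex (s : ℕ) : ∃ x : ZMod d, ∀ k j : ℤ, T.entry (cell d L k j) = s + 1 → x = k := by
    by_cases h : ∃ k j : ℤ, T.entry (cell d L k j) = s + 1
    · obtain ⟨k, j, h⟩ := h
      refine ⟨k, fun k' j' h' => ?_⟩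
      exact ((cell_eq_cell_iff mu.periodic _ _ _ _).1 (hcell (by omega) (h.trans h'.symm))).1
    · exact ⟨0, fun k j h' => (h ⟨k, j, h'⟩).elim⟩
  choose w hw using hex
  have hsurj (s : ℕ) (hs : s < n) (k : ℤ) (hk : w s = k) :
      ∃ j, T.entry (cell d L k j) = s + 1 := by
    obtain ⟨c, -, hc⟩ := T.bijOn.surjOn (show s + 1 ∈ Set.Icc 1 n from ⟨by omega, hs⟩)
    obtain ⟨r, q, rfl⟩ := exists_cell_eq c
    refine ⟨q - mu.row r + mu.row k, ?_⟩
    rw [← hc, (cell_eq_cell_iff mu.periodic k _ r q).2 ⟨hk.symm.trans (hw s r q hc), by omega⟩]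
  have hlt (k j : ℤ) (s : ℕ) (h : T.entry (cell d L k j) = s + 1) : s < n := by
    have := T.bijOn.mapsTo ((cell_mem_skew_iff _ _ _ _).2 ((hne k j).1 (by omega)))
    have := this.2
    omega
  have hcount (k j : ℤ) (s : ℕ) (h : T.entry (cell d L k j) = s + 1) :
      j = mu.row k + count w s k + 1 := by
    have hj := (hne k j).1 (by omega)
    have hc : count w s k = ((Finset.range s).filter fun t => w t = k).card := by
      rw [count, Finset.sum_boole]
    -- The cells to the left of column `j` in row `k` correspond to the earlier letters equal to
    -- `k`, because entries increase along the row.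
    have hcard : (Finset.Ioo (mu.row k) j).card =
        ((Finset.range s).filter fun t => w t = k).card := by
      refine Finset.card_bij (fun q _ => T.entry (cell d L k q) - 1) (fun q hq => ?_)
        (fun q hq q' hq' hqq => ?_) (fun t ht => ?_)
      · rw [Finset.mem_Ioo] at hq
        have h1 := T.entry_lt_entry hq.1 hq.2 hj.2
        have h2 := (hne k q).2 ⟨hq.1, by omega⟩
        rw [Finset.mem_filter, Finset.mem_range]
        exact ⟨by omega, hw _ k q (by omega)⟩
      · rw [Finset.mem_Ioo] at hq hq'
        have h1 := (hne k q).2 ⟨hq.1, by omega⟩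
        have h2 := (hne k q').2 ⟨hq'.1, by omega⟩
        have h3 := ((cell_eq_cell_iff mu.periodic _ _ _ _).1
          (hcell (k := k) (j := q) (k' := k) (j' := q') h1 (by omega))).2
        omega
      · rw [Finset.mem_filter, Finset.mem_range] at ht
        obtain ⟨q, hq⟩ := hsurj t (ht.1.trans (hlt _ _ _ h)) k ht.2
        have h1 := (hne k q).1 (by omega)
        refine ⟨q, Finset.mem_Ioo.2 ⟨h1.1, ?_⟩, by omega⟩
        by_contra hqj
        rcases eq_or_lt_of_le (not_lt.1 hqj) with he | hl
        · subst he
          omega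
        · have := T.entry_lt_entry hj.1 hl h1.2
          omega
    rw [Int.card_Ioo] at hcard
    omega
  have hlam (k : ℤ) : lam.row k = mu.row k + count w n k := by
    refine le_antisymm (not_lt.1 fun hlk => ?_) (not_lt.1 fun hlk => ?_)
    · have h0 := count_nonneg w n k
      obtain ⟨s, hs⟩ := Nat.exists_eq_succ_of_ne_zero
        ((hne k (mu.row k + count w n k + 1)).2 ⟨by omega, by omega⟩)
      have h1 := hcount _ _ _ hs
      have h2 := count_lt_count (hlt _ _ _ hs) (hw _ _ _ hs)
      omega
    · have h0 := T.inner_le_outer k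
      obtain ⟨t, ht, hwt, hq⟩ := exists_count_eq (w := w) (s := n) (x := k)
        (q := lam.row k - mu.row k) (by omega) (by omega)
      obtain ⟨j, hj⟩ := hsurj t ht k hwt
      have h1 := hcount _ _ _ hj
      have h2 := (hne k j).1 (by omega)
      omega
  have henc : T.toFilling.Encodes n w := by
    refine ⟨mu.periodic, hlam, fun k j s => ⟨fun h => ?_, ?_⟩⟩
    · exact ⟨hlt _ _ _ h, hw s k j h, hcount k j s h⟩
    · rintro ⟨hs, hk, rfl⟩
      obtain ⟨j, hj⟩ := hsurj s hs k hk
      rw [← hj, hcount k j s hj]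
      rfl
  refine ⟨w, henc, fun s hs => antitone_int_of_succ_le fun k => ?_⟩
  by_contra hk
  rw [not_le] at hk
  have hmu := mu.antitone_row (show k ≤ k + 1 by omega)
  have hla := lam.antitone_row (show k ≤ k + 1 by omega)
  have h0 := count_nonneg w s k
  have h1 := count_mono w ((k + 1 : ℤ) : ZMod d) hs
  simp only at h1
  -- This is the first column that row `k` has not reached at stage `s`. If row `k + 1` has reached
  -- it, its entry there is at most `s`, and by column strictness so is the entry above, which would
  -- put `j` inside row `k` at stage `s`.
  set j := mu.row k + count w s k + 1 with hj
  have h2 := (henc.entry_le_iff hs (k + 1) j).2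
    ⟨show mu.row (k + 1) < j by omega, show j ≤ mu.row (k + 1) + _ by omega⟩
  have h3 := (henc.entry_le_iff hs k j).1
  have h4 : T.entry (cell d L k j) ≠ 0 := (hne k j).2 ⟨by omega, by have := hlam (k + 1); omega⟩
  have h5 := T.col_lt k j ((cell_mem_skew_iff _ _ _ _).2 ((hne _ _).1 h4))
    ((cell_mem_skew_iff _ _ _ _).2 ((hne _ _).1 h2.1))
  have h6 : j ≤ mu.row k + count w s k := (h3 ⟨h4, h5.le.trans h2.2⟩).2
  omega

/-! ### Internal insertion on words -/

/-- The row in which the shapes before and after an internal insertion at row `x` differ, once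
the first `s` letters have been taken into account. -/
def carrier (x : ZMod d) (w : ℕ → ZMod d) : ℕ → ZMod d
  | 0 => x
  | s + 1 => if w s = carrier x w s then carrier x w s + 1 else carrier x w s

/-- The word of the tableau obtained by internal insertion at row `x`. -/
def insertWord (x : ZMod d) (w : ℕ → ZMod d) (s : ℕ) : ZMod d :=
  if w s = carrier x w s then w s + 1 else w s

/-- The two routes to the same shape: first `x` and then the new word, or the old word and then the
carrier. Each application of the local rule preserves the balance. -/
theorem count_insertWord (x : ZMod d) (w : ℕ → ZMod d) (s : ℕ) (y : ZMod d) :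
    (if x = y then 1 else 0) + count (insertWord x w) s y =
      count w s y + if carrier x w s = y then 1 else 0 := by
  induction s with
  | zero =>
    rw [count_zero, count_zero, add_zero, zero_add]
    rfl
  | succ s ih =>
    simp only [count_succ, carrier, insertWord]
    by_cases h : w s = carrier x w s
    · simp only [h, if_true]
      omega
    · simp only [h, if_false]
      omega

theorem carrier_eq_of_forall_ne {x y : ZMod d} {w : ℕ → ZMod d} {s t : ℕ} (hst : s ≤ t)
    (hs : carrier x w s = y) (h : ∀ u, s ≤ u → u < t → w u ≠ y) : carrier x w t = y := by
  induction t, hst using Nat.le_induction with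
  | base => exact hs
  | succ t hst ih =>
    have h1 := ih fun u h1 h2 => h u h1 (by omega)
    rw [carrier, h1, if_neg (h t hst (by omega))]

/-- The state of an internal insertion at row `x` when the entry `s + 1` is about to be inserted
into the next row: smaller entries are in their final position, larger ones have not moved. -/
structure Filling.Pending (S : Filling d L) (f : ℤ → ℤ) (n : ℕ) (w : ℕ → ZMod d) (x : ZMod d)
    (s : ℕ) : Prop where
  periodic : ∀ i, S.inner i = S.inner (i + d) + L
  inner_eq : ∀ k : ℤ, S.inner k = f k + if x = k then 1 else 0
  outer_eq : ∀ k : ℤ, S.outer k = f k + count w n k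
  lt : s < n
  letter_eq : w s = carrier x w s
  entry_iff : ∀ (k j : ℤ) (t : ℕ), S.entry (cell d L k j) = t + 1 ↔
    (t < s ∧ insertWord x w t = k ∧ j = S.inner k + count (insertWord x w) t k + 1) ∨
    (s < t ∧ t < n ∧ w t = k ∧ j = f k + count w t k + 1)

theorem Filling.Pending.carrier_succ {S : Filling d L} {f : ℤ → ℤ} {n s : ℕ} {w : ℕ → ZMod d}
    {x : ZMod d} (h : S.Pending f n w x s) : insertWord x w s = carrier x w (s + 1) := by
  simp [insertWord, carrier, h.letter_eq]

theorem Filling.Pending.inner_add_count {S : Filling d L} {f : ℤ → ℤ} {n s : ℕ}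
    {w : ℕ → ZMod d} {x : ZMod d} (h : S.Pending f n w x s) (t : ℕ) (k : ℤ) :
    S.inner k + count (insertWord x w) t k =
      f k + count w t k + if carrier x w t = k then 1 else 0 := by
  have := count_insertWord x w t k
  rw [h.inner_eq]
  omega

/-- Before the next occurrence of the carrier row, the letters and positions do not change. -/
theorem Filling.Pending.position_iff {S : Filling d L} {f : ℤ → ℤ} {n s : ℕ}
    {w : ℕ → ZMod d} {x : ZMod d} (h : S.Pending f n w x s) {t u : ℕ} (hsu : s < u) (hut : u < t)
    (hne : ∀ v, s < v → v < t → w v ≠ carrier x w (s + 1)) (k j : ℤ) :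
    (insertWord x w u = k ∧ j = S.inner k + count (insertWord x w) u k + 1) ↔
      (w u = k ∧ j = f k + count w u k + 1) := by
  have hc : carrier x w u = carrier x w (s + 1) :=
    carrier_eq_of_forall_ne hsu rfl fun v h1 h2 => hne v h1 (h2.trans hut)
  have hw := hne u hsu hut
  rw [← hc] at hw
  rw [insertWord, if_neg hw, h.inner_add_count]
  refine and_congr_right fun hk => ?_
  rw [if_neg (by rw [← hk]; exact hw.symm), add_zero]

/-- The final position of the entry `s + 1`. -/
theorem Filling.Pending.position_eq {S : Filling d L} {f : ℤ → ℤ} {n s : ℕ}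
    {w : ℕ → ZMod d} {x : ZMod d} (h : S.Pending f n w x s) {t : ℕ} (hst : s < t)
    (hne : ∀ v, s < v → v < t → w v ≠ carrier x w (s + 1)) (r : ℤ)
    (hr : (r : ZMod d) = carrier x w (s + 1)) :
    f r + count w t r = S.inner r + count (insertWord x w) s r := by
  have h1 := h.inner_add_count (s + 1) r
  rw [if_pos hr.symm, count_succ, if_pos (h.carrier_succ.trans hr.symm)] at h1
  rw [count_eq_of_forall_ne (Nat.succ_le_of_lt hst) fun v hv hvt => by rw [hr]; exact hne v hv hvt,
    Nat.succ_eq_add_one]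
  omega

/-- If `t` is the next occurrence of the carrier row, or the end of the word, then putting `s + 1`
into its final position gives the entries of the state `t`. -/
theorem Filling.Pending.update_entry_iff {S : Filling d L} {f : ℤ → ℤ} {n s : ℕ}
    {w : ℕ → ZMod d} {x : ZMod d} (h : S.Pending f n w x s) {t : ℕ} (hst : s < t) (htn : t ≤ n)
    (hne : ∀ v, s < v → v < t → w v ≠ carrier x w (s + 1))
    (ht : t < n → w t = carrier x w (s + 1)) (r : ℤ)
    (hr : (r : ZMod d) = carrier x w (s + 1)) (k j : ℤ) (u : ℕ) :
    (S.entry.update (cell d L r (f r + count w t r + 1)) (s + 1)) (cell d L k j) = u + 1 ↔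
    (u < t ∧ insertWord x w u = k ∧ j = S.inner k + count (insertWord x w) u k + 1) ∨
    (t < u ∧ u < n ∧ w u = k ∧ j = f k + count w u k + 1) := by
  classical
  -- The overwritten cell is the final position of `s + 1`. Before the update it holds `t + 1` if `t
  -- < n`, and it is the new cell at the end of the row if `t = n`.
  have hpos := h.position_eq hst hne
  have hposr := hpos r hr
  have hcs := h.carrier_succ
  have hiff := cell_eq_cell_iff h.periodic k j r (f r + count w t r + 1)
  rw [Finsupp.coe_update, Function.update_apply]
  split_ifs with hc
  · obtain ⟨hk, hj⟩ := hiff.1 hc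
    have hj' : j = S.inner k + count (insertWord x w) s k + 1 := by
      rw [hk]
      omega
    constructor
    · intro hsu
      obtain rfl : s = u := by omega
      exact Or.inl ⟨hst, by rw [hcs, hk, hr], hj'⟩
    · rintro (⟨h1, h2, h3⟩ | ⟨h1, h2, h3, h4⟩)
      · rcases lt_trichotomy s u with h4 | h4 | h4
        · have := (h.position_iff h4 h1 hne k j).1 ⟨h2, h3⟩
          exact (hne u h4 h1 (by rw [this.1, hk, hr])).elim
        · rw [h4]
        · have := count_lt_count h4 h2
          omega
      · have h5 := count_lt_count h1 (show w t = k by rw [ht (h1.trans h2), hk, hr])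
        have h6 := hpos k (hk.trans hr)
        omega
  · rw [hiff] at hc
    rw [h.entry_iff]
    constructor
    · rintro (⟨h1, h2⟩ | ⟨h1, h2, h3⟩)
      · exact Or.inl ⟨h1.trans hst, h2⟩
      · rcases lt_trichotomy u t with h4 | h4 | h4
        · exact Or.inl ⟨h4, (h.position_iff h1 h4 hne k j).2 h3⟩
        · subst h4
          have hk : (k : ZMod d) = carrier x w (s + 1) := by rw [← h3.1, ht h2]
          have h5 := hpos k hk
          have hkr : (k : ZMod d) = r := hk.trans hr.symm
          refine (hc ⟨hkr, ?_⟩).elim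
          rw [hkr] at h5 h3
          omega
        · exact Or.inr ⟨h4, h2, h3⟩
    · rintro (⟨h1, h2⟩ | ⟨h1, h2⟩)
      · rcases lt_trichotomy s u with h4 | h4 | h4
        · exact Or.inr ⟨h4, by omega, (h.position_iff h4 h1 hne k j).1 h2⟩
        · subst h4
          have hk : (k : ZMod d) = r := by rw [← h2.1, hcs, hr]
          refine (hc ⟨hk, ?_⟩).elim
          rw [hk] at h2
          omega
        · exact Or.inl ⟨h4, h2⟩
      · exact Or.inr ⟨by omega, h2⟩

/-- The larger entries of row `r` are the unmoved ones whose letter is the carrier. The smallest is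
thus the next occurrence of the carrier, and bumping it is the next raise. If there is none, the
carrier is already final and names the row of the new cell. The induction is on `n - s`. -/
theorem Filling.Pending.insertRow {n : ℕ} {f : ℤ → ℤ} {w : ℕ → ZMod d} {x : ZMod d} :
    ∀ {s : ℕ} {S : Filling d L} (_ : S.Pending f n w x s) {r : ℤ}
      (_ : (r : ZMod d) = carrier x w (s + 1)),
    (S.insertRow r (s + 1)).1.Encodes n (insertWord x w) ∧
      (S.insertRow r (s + 1)).1.inner = S.inner ∧
      ((S.insertRow r (s + 1)).2.1 : ZMod d) = carrier x w n ∧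
      (S.insertRow r (s + 1)).2.2 = S.outer (S.insertRow r (s + 1)).2.1 + 1 := by
  intro s
  induction hm : n - s using Nat.strong_induction_on generalizing s with
  | _ m ih =>
  intro S h r hr
  have hvr (v : ℕ) (h1 : s < v) (h2 : v < n) (h3 : w v = carrier x w (s + 1)) :
      S.entry (cell d L r (f r + count w v r + 1)) = v + 1 :=
    (h.entry_iff _ _ _).2 (Or.inr ⟨h1, h2, h3.trans hr.symm, rfl⟩)
  have hlarge (j : ℤ) (hj : s + 1 < S.entry (cell d L r j)) :
      ∃ t, S.entry (cell d L r j) = t + 1 ∧ s < t ∧ t < n ∧ w t = r ∧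
        j = f r + count w t r + 1 := by
    obtain ⟨t, ht⟩ := Nat.exists_eq_succ_of_ne_zero (show S.entry (cell d L r j) ≠ 0 by omega)
    rcases (h.entry_iff _ _ _).1 ht with h1 | h1
    · omega
    · exact ⟨t, ht, h1⟩
  rw [Filling.insertRow]
  split_ifs with hex
  · obtain ⟨hgt, hmin⟩ := hex.choose_spec
    generalize hex.choose = j at hgt hmin
    obtain ⟨t, ht, hst, htn, hwt, rfl⟩ := hlarge j hgt
    have hne (v : ℕ) (h1 : s < v) (h2 : v < t) : w v ≠ carrier x w (s + 1) := fun h3 => by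
      have h4 := hvr v h1 (h2.trans htn) h3
      have := hmin _ (by rw [h4]; omega)
      omega
    have hct : carrier x w t = carrier x w (s + 1) := carrier_eq_of_forall_ne hst rfl hne
    have hp : (S.replace (cell d L r (f r + count w t r + 1)) (s + 1)).Pending f n w x t :=
      { periodic := h.periodic
        inner_eq := h.inner_eq
        outer_eq := h.outer_eq
        lt := htn
        letter_eq := by rw [hwt, hct, hr]
        entry_iff := h.update_entry_iff hst htn.le hne (fun _ => hwt.trans hr) r hr }
    rw [ht]
    exact ih (n - t) (by omega) rfl hp (by
      rw [carrier, hct, ← hr, hwt, if_pos rfl, Int.cast_add, Int.cast_one])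
  · have hne (v : ℕ) (h1 : s < v) (h2 : v < n) : w v ≠ carrier x w (s + 1) := fun h3 => by
      classical
      -- The first such occurrence would be a bumped entry, contrary to `hex`.
      have hv : ∃ v, s < v ∧ v < n ∧ w v = carrier x w (s + 1) := ⟨v, h1, h2, h3⟩
      obtain ⟨h4, h5, h6⟩ := Nat.find_spec hv
      have h7 := hvr _ h4 h5 h6
      refine hex ⟨_, by rw [h7]; omega, fun j' hj' => ?_⟩
      obtain ⟨t, ht, h8, h9, h10, -⟩ := hlarge j' hj'
      have := Nat.find_min' hv ⟨h8, h9, h10.trans hr⟩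
      omega
    have hcn : carrier x w n = carrier x w (s + 1) := carrier_eq_of_forall_ne h.lt rfl hne
    refine ⟨⟨h.periodic, fun k => ?_, fun k j u => ?_⟩, rfl, hr.trans hcn.symm, rfl⟩
    · simp only [Filling.place]
      rw [addToRow_apply, h.outer_eq, h.inner_add_count, hcn, hr]
    · simp only [Filling.place]
      rw [h.outer_eq, h.update_entry_iff h.lt le_rfl hne (by omega) r hr]
      constructor
      · rintro (h1 | h1)
        · exact h1
        · omega
      · exact Or.inl

theorem periodic_addToRow {f : ℤ → ℤ} (hf : ∀ i, f i = f (i + d) + L) (i k : ℤ) :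
    addToRow d i f k = addToRow d i f (k + d) + L := by
  have := hf k
  simp only [addToRow_apply, Int.cast_add, Int.cast_natCast, ZMod.natCast_self, add_zero]
  omega

/-- Internal insertion of a tableau in terms of its word. -/
theorem Filling.Encodes.ins {S : Filling d L} {n : ℕ} {w : ℕ → ZMod d} (h : S.Encodes n w)
    (i : ℤ) :
    (S.ins i).1.Encodes n (insertWord i w) ∧ (S.ins i).1.inner = addToRow d i S.inner ∧
      ((S.ins i).2.1 : ZMod d) = carrier i w n ∧ (S.ins i).2.2 = S.outer (S.ins i).2.1 + 1 := by
  classical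
  have key {s : ℕ} (hs : ∀ v < s, w v ≠ i) (t : ℕ) (ht : t < s) (k j : ℤ) :
      (insertWord i w t = k ∧
        j = addToRow d i S.inner k + count (insertWord i w) t k + 1) ↔
      (w t = k ∧ j = S.inner k + count w t k + 1) := by
    have hc : carrier i w t = i :=
      carrier_eq_of_forall_ne (Nat.zero_le t) rfl fun v _ hv => hs v (hv.trans ht)
    have h1 := hs t ht
    have h2 := count_insertWord i w t k
    rw [insertWord, if_neg (by rwa [hc]), addToRow_apply]
    refine and_congr_right fun hk => ?_
    rw [hk] at h1
    rw [hc, if_neg h1.symm] at h2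
    rw [if_neg h1.symm]
    omega
  rw [Filling.ins]
  split_ifs with h0
  · have hn : ∀ v < n, w v ≠ i := by
      intro v hv hvi
      have h1 := count_lt_count hv hvi
      have h2 := count_nonneg w v i
      have := (h.entry_le_iff le_rfl i (S.inner i + 1)).2 ⟨by omega, by omega⟩
      exact this.1 h0
    have hc : carrier i w n = i :=
      carrier_eq_of_forall_ne (Nat.zero_le n) rfl fun v _ hv => hn v hv
    refine ⟨⟨periodic_addToRow h.periodic i, fun k => ?_, fun k j s => ?_⟩, rfl, hc.symm, rfl⟩
    · have h2 := count_insertWord i w n k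
      rw [hc] at h2
      simp only [addToRow_apply, h.outer_eq]
      omega
    · rw [h.entry_iff]
      exact and_congr_right fun hs => (key hn s hs k j).symm
  · obtain ⟨s, hs⟩ := Nat.exists_eq_succ_of_ne_zero h0
    obtain ⟨hsn, hws, hj⟩ := (h.entry_iff _ _ _).1 hs
    -- The first cell of the row holds the first occurrence of `i`, so nothing changes before the
    -- letter `w s`.
    have hn : ∀ v < s, w v ≠ i := by
      intro v hv hvi
      have h1 := count_lt_count hv hvi
      have h2 := count_nonneg w v i
      omega
    have hc : carrier i w s = i :=
      carrier_eq_of_forall_ne (Nat.zero_le s) rfl fun v _ hv => hn v hv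
    have hp : Filling.Pending ⟨S.outer, addToRow d i S.inner,
        S.entry.update (cell d L i (S.inner i + 1)) 0⟩ S.inner n w i s := by
      refine ⟨periodic_addToRow h.periodic i, addToRow_apply i S.inner, h.outer_eq, hsn,
        hws.trans hc.symm, fun k j t => ?_⟩
      simp only [Finsupp.coe_update, Function.update_apply]
      have hiff := cell_eq_cell_iff h.periodic k j i (S.inner i + 1)
      split_ifs with hcell
      · have hs' : S.entry (cell d L k j) = s + 1 := by rw [hcell, hs]
        constructor
        · exact False.elim
        · rintro (⟨h1, h2⟩ | ⟨h1, h2⟩)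
          · have := (h.entry_iff k j t).2 ⟨by omega, (key hn t h1 k j).1 h2⟩
            omega
          · have := (h.entry_iff k j t).2 h2
            omega
      · rw [h.entry_iff]
        constructor
        · rintro ⟨h1, h2, h3⟩
          rcases lt_trichotomy t s with h4 | h4 | h4
          · exact Or.inl ⟨h4, (key hn t h4 k j).2 ⟨h2, h3⟩⟩
          · rw [h4] at h2 h3
            have hki : (k : ZMod d) = i := h2.symm.trans hws
            refine (hcell (hiff.2 ⟨hki, ?_⟩)).elim
            rw [hki] at h3
            omega
          · exact Or.inr ⟨h4, h1, h2, h3⟩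
        · rintro (⟨h1, h2⟩ | ⟨h1, h2⟩)
          · exact ⟨by omega, (key hn t h1 k j).1 h2⟩
          · exact h2
    rw [hs]
    exact hp.insertRow (by
      rw [carrier, hc, hws, if_pos rfl, Int.cast_add, Int.cast_one])

/-- By `count_insertWord` each new shape is the old one with an extra cell in the carrier row, so it
suffices to follow that cell through the local rule. -/
theorem IsLattice.insertWord {f g : ℤ → ℤ} {n : ℕ} {w : ℕ → ZMod d} {x : ZMod d}
    (h : IsLattice f n w) (hg : ∀ k : ℤ, g k = f k + if x = k then 1 else 0) (hga : Antitone g) :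
    IsLattice g n (insertWord x w) := by
  intro s hs
  have hrw : (fun k : ℤ => g k + count (CylindricRS.insertWord x w) s k) =
      fun k : ℤ => f k + count w s k + if carrier x w s = k then 1 else 0 := by
    funext k
    have := count_insertWord x w s k
    rw [hg]
    omega
  rw [hrw]
  clear hrw
  induction s with
  | zero =>
    simp only [count_zero, add_zero]
    rwa [show g = _ from funext hg] at hga
  | succ s ih =>
    refine antitone_int_of_succ_le fun k => ?_
    have hk : k ≤ k + 1 := by omega
    have h1 := h s (by omega) hk
    have h2 := h (s + 1) hs hk
    have h3 := ih (by omega) hk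
    clear ih
    have hcs : carrier x w (s + 1) =
      if w s = carrier x w s then carrier x w s + 1 else carrier x w s := rfl
    simp only [count_succ] at h1 h2 h3 ⊢
    generalize carrier x w (s + 1) = c' at *
    generalize carrier x w s = c at *
    push_cast at *
    -- If letter and carrier agree, the cell added in row `c + 1` is supported by the one added in
    -- row `c`. If they differ, at most one of them lengthens row `k + 1`, and the shape with that
    -- cell alone, old (`h2`) or new (`h3`), is already antitone.
    by_cases hc : w s = c
    · rw [if_pos hc] at hcs
      subst hcs
      simp only [hc, add_left_inj] at *
      by_cases h4 : c = k
      · by_cases h5 : c = k + 1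
        · have h6 : c + 1 = k := by rw [h4, ← h5, h4]
          simp only [if_pos h4, if_pos h5, if_pos h6] at *
          omega
        · simp only [if_pos h4, if_neg h5] at *
          split_ifs <;> omega
      · simp only [if_neg h4] at *
        split_ifs at * <;> omega
    · rw [if_neg hc] at hcs
      rw [hcs]
      by_cases h4 : w s = k + 1
      · have h5 : c ≠ k + 1 := fun h5 => hc (h4.trans h5.symm)
        simp only [if_pos h4, if_neg h5] at h2 h3 ⊢
        split_ifs at * <;> omega
      · simp only [if_neg h4] at *
        split_ifs at * <;> omega

/-! ### Growth -/

/-- The word obtained from `w` by successive internal insertions at the rows `u 0, …, u (t - 1)`. -/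
def growth (u w : ℕ → ZMod d) : ℕ → ℕ → ZMod d
  | 0 => w
  | t + 1 => insertWord (u t) (growth u w t)

/-- The symmetry of the local rule. -/
theorem growth_symm (u w : ℕ → ZMod d) (t s : ℕ) :
    growth u w t s = carrier (w s) (growth w u s) t := by
  induction t generalizing s with
  | zero => rfl
  | succ t ih =>
    -- The same symmetry for the other family of edges: the carriers of insertion `t` are the
    -- letters of the transposed grid. Together with `ih` it propagates across one strip.
    have hc (s : ℕ) : carrier (u t) (growth u w t) s = growth w u s t := by
      induction s with
      | zero => rfl
      | succ s ihs =>
        simp only [carrier, growth, insertWord]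
        rw [ihs, ih s]
        by_cases h : growth w u s t = carrier (w s) (growth w u s) t
        · simp [h]
        · rw [if_neg h, if_neg (Ne.symm h)]
    simp only [growth, insertWord, carrier]
    rw [hc, ih s]
    by_cases h : growth w u s t = carrier (w s) (growth w u s) t
    · simp [h]
    · rw [if_neg h, if_neg (Ne.symm h)]

theorem Filling.Encodes.place {S : Filling d L} {n : ℕ} {w : ℕ → ZMod d} (h : S.Encodes n w)
    {r : ℤ} (hr : (r : ZMod d) = w n) : (S.place r (S.outer r + 1) (n + 1)).Encodes (n + 1) w := by
  classical
  refine ⟨h.periodic, fun k => ?_, fun k j s => ?_⟩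
  · simp only [Filling.place]
    rw [addToRow_apply, h.outer_eq, count_succ, hr]
    omega
  · simp only [Filling.place, Finsupp.coe_update, Function.update_apply]
    have hiff := cell_eq_cell_iff h.periodic k j r (S.outer r + 1)
    have hout := h.outer_eq r
    split_ifs with hc
    · obtain ⟨h1, h2⟩ := hiff.1 hc
      constructor
      · intro hs
        obtain rfl : n = s := by omega
        refine ⟨by omega, by rw [h1, hr], ?_⟩
        rw [h1]
        omega
      · rintro ⟨h3, h4, h5⟩
        by_contra hns
        have := count_lt_count (show s < n by omega) h4
        rw [h1] at this h5
        omega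
    · rw [h.entry_iff]
      constructor
      · rintro ⟨h1, h2⟩
        exact ⟨by omega, h2⟩
      · rintro ⟨h1, h2, h3⟩
        refine ⟨lt_of_le_of_ne (by omega) ?_, h2, h3⟩
        rintro rfl
        have hk : (k : ZMod d) = r := h2.symm.trans hr.symm
        refine hc (hiff.2 ⟨hk, ?_⟩)
        rw [hk] at h3
        omega

theorem SCT.rowOf_eq (hd : 0 < d) {lam mu : CylShape d L} {U : SCT lam mu} {m : ℕ}
    {u : ℕ → ZMod d} (h : U.toFilling.Encodes m u) {t : ℕ} (ht : t < m) :
    (U.rowOf (t + 1) : ZMod d) = u t := by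
  have : NeZero d := ⟨hd.ne'⟩
  have hex : ∃ i : ℤ, 1 ≤ i ∧ i ≤ d ∧ ∃ j : ℤ, U.entry (cell d L i j) = t + 1 := by
    -- Subtracting `1` before taking the residue and adding it back gives a representative in `{1,
    -- …, d}` instead of `{0, …, d - 1}`.
    have hlt := ZMod.val_lt (u t - 1)
    have hcast : (((u t - 1).val + 1 : ℤ) : ZMod d) = u t := by
      push_cast
      rw [ZMod.natCast_zmod_val]
      ring
    exact ⟨(u t - 1).val + 1, by omega, by omega, _,
      (h.entry_iff _ _ t).2 ⟨ht, hcast.symm, rfl⟩⟩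
  obtain ⟨-, -, j, hj⟩ := Classical.epsilon_spec hex
  exact ((h.entry_iff _ j t).1 hj).2.1.symm

/-! ### The correspondence as a grid of local rules -/

section Correspondence

variable {al be mu : CylShape d L} {T : SCT al mu} {U : SCT be mu} {n m : ℕ}
  {w u : ℕ → ZMod d}

/-- The tableaux of the correspondence in terms of words. -/
theorem crsStep_encodes (hd : 0 < d) (hT : T.toFilling.Encodes n w) (hU : U.toFilling.Encodes m u)
    {t : ℕ} (ht : t ≤ m) :
    (crsStep T U t).1.Encodes n (growth u w t) ∧
      (∀ k : ℤ, (crsStep T U t).1.inner k = mu.row k + count u t k) ∧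
      (crsStep T U t).2.Encodes t (fun s => growth w u n s) ∧
      (crsStep T U t).2.inner = al.row ∧
      (crsStep T U t).2.outer = (crsStep T U t).1.outer := by
  induction t with
  | zero =>
    refine ⟨hT, fun k => by simp [crsStep, SCT.toFilling], ⟨al.periodic, ?_, ?_⟩, rfl, rfl⟩
    · simp [crsStep]
    · simp [crsStep]
  | succ t ih =>
    obtain ⟨h1, h2, h3, h4, h5⟩ := ih (by omega)
    have hrow : (U.rowOf (t + 1) : ZMod d) = u t := SCT.rowOf_eq hd hU (by omega)
    obtain ⟨e1, e2, e3, e4⟩ := h1.ins (U.rowOf (t + 1))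
    simp only [crsStep]
    generalize (crsStep T U t).1.ins (U.rowOf (t + 1)) = R at *
    rw [hrow] at e1 e3
    rw [← h5] at e4
    rw [e4]
    -- The new cell lies in the final carrier row, which by symmetry is letter `t` of the transposed
    -- growth: exactly the next letter of the recording tableau.
    refine ⟨e1, fun k => ?_, h3.place (by rw [e3, growth_symm]), h4, ?_⟩
    · rw [e2, addToRow_apply, hrow, h2, count_succ]
      omega
    · funext k
      have h6 := count_insertWord (u t) (growth u w t) n k
      simp only [Filling.place]
      rw [addToRow_apply, e1.outer_eq, e2, addToRow_apply, hrow, h5, h1.outer_eq, e3]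
      omega

/-- The inner shapes run through the chain of `u`, so `hu` supplies the antitone inner boundary
needed at each insertion. -/
theorem isLattice_growth (hw : IsLattice mu.row n w) (hu : IsLattice mu.row m u) {t : ℕ}
    (ht : t ≤ m) : IsLattice (fun k => mu.row k + count u t k) n (growth u w t) := by
  induction t with
  | zero => simpa [growth] using hw
  | succ t ih =>
    refine (ih (by omega)).insertWord (fun k => ?_) (hu (t + 1) ht)
    rw [count_succ]
    omega

end Correspondence

end CylindricRS

/-- The first part says that the correspondence produces a pair of standard cylindric tableaux of
the right shapes; the second part is its symmetry. -/
theorem mainTheorem9 (d L : ℕ) (hd : 0 < d) (hL : 0 < L) (al be mu : CylindricRS.CylShape d L)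
    (T : CylindricRS.SCT al mu) (U : CylindricRS.SCT be mu) :
    (∃ (lam : CylindricRS.CylShape d L) (P : CylindricRS.SCT lam be) (Q : CylindricRS.SCT lam al),
      CylindricRS.size lam be = CylindricRS.size al mu ∧
      CylindricRS.size lam al = CylindricRS.size be mu ∧
      CylindricRS.CRS T U = (P.toFilling, Q.toFilling)) ∧
    ∀ (lam : CylindricRS.CylShape d L) (P : CylindricRS.SCT lam be) (Q : CylindricRS.SCT lam al),
      CylindricRS.CRS T U = (P.toFilling, Q.toFilling) →
      CylindricRS.CRS U T = (Q.toFilling, P.toFilling) := by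
  open CylindricRS in
  obtain ⟨w, hT, hw⟩ := T.exists_encodes
  obtain ⟨u, hU, hu⟩ := U.exists_encodes
  obtain ⟨p1, p2, p3, p4, p5⟩ := crsStep_encodes hd hT hU le_rfl
  obtain ⟨q1, q2, q3, q4, -⟩ := crsStep_encodes hd hU hT le_rfl
  have hal (k : ℤ) : al.row k = mu.row k + count w (size al mu) k := hT.outer_eq k
  have hbe (k : ℤ) : be.row k = mu.row k + count u (size be mu) k := hU.outer_eq k
  have hPi : (CRS T U).1.inner = be.row := funext fun k => (p2 k).trans (hbe k).symm
  have hP'i : (CRS U T).1.inner = al.row := funext fun k => (q2 k).trans (hal k).symm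
  refine ⟨?_, fun lam P Q h => ?_⟩
  · have hPl : IsLattice be.row (size al mu) (growth u w (size be mu)) := by
      rw [show be.row = _ from funext hbe]
      exact isLattice_growth hw hu le_rfl
    have hQl : IsLattice al.row (size be mu) (growth w u (size al mu)) := by
      rw [show al.row = _ from funext hal]
      exact isLattice_growth hu hw le_rfl
    have hout : (CRS T U).1.outer = fun k : ℤ =>
        be.row k + count (growth u w (size be mu)) (size al mu) k := by
      funext k
      rw [← hPi]
      exact p1.outer_eq k
    let lam : CylShape d L :=
      { row := (CRS T U).1.outer
        antitone_row := by
          rw [hout]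
          exact hPl _ le_rfl
        periodic := fun i => by
          have := be.periodic i
          simp only [hout, Int.cast_add, Int.cast_natCast, ZMod.natCast_self, add_zero]
          omega }
    obtain ⟨s1, P, hP⟩ := p1.exists_SCT hL (lam := lam) rfl hPi hPl
    obtain ⟨s2, Q, hQ⟩ := p3.exists_SCT hL (lam := lam) p5 p4 hQl
    exact ⟨lam, P, Q, s1, s2, Prod.ext hP.symm hQ.symm⟩
  · have h1 : (CRS U T).1 = (CRS T U).2 :=
      q1.eq_of_inner_eq p3 (fun _ _ => rfl) (hP'i.trans p4.symm)
    have h2 : (CRS U T).2 = (CRS T U).1 :=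
      q3.eq_of_inner_eq p1 (fun _ _ => rfl) (q4.trans hPi.symm)
    rw [h] at h1 h2
    exact Prod.ext h1 h2
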